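/- Say that a permutation $\pi$ of $\{1,\dots,n\}$, written in one-line notation, contains the pattern $1342$ if it has a subsequence of length four that is order isomorphic to $1342$, i.e. if there are $i_1<i_2<i_3<i_4$ with $\pi(i_1)<\pi(i_4)<\pi(i_2)<\pi(i_3)$; otherwise $\pi$ avoids $1342$. Let $a_n$ be the number of involutions $\pi$ of $\{1,\dots,n\}$ (permutations with $\pi\circ\pi=\mathrm{id}$, the identity included) that avoid $1342$. Then the generating function $g(x)=\sum_{n\ge 1}a_nx^n$ is, as a formal power series, $$g(x)=\frac{x\left(1-2x+x^2+\sqrt{1-6x^2+x^4}\right)}{2\left(1-3x+x^2\right)},$$ where $\sqrt{1-6x^2+x^4}$ denotes the formal power series with constant term $1$ whose square is $1-6x^2+x^4$. Moreover, the growth rate $\lim_{n\to\infty}\sqrt[n]{a_n}$ exists and equals $$1+\frac{1+\sqrt5}{2}\approx 2.62.$$ -/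

import Mathlib

open Filter Topology

/-- `π` contains the pattern `σ`: some subsequence of the one-line notation of `π`, of the same
length as `σ`, is order isomorphic to `σ`. Permutations of length `n` act on `Fin n`, that is,
positions and values are numbered from `0`. -/
def ContainsPattern {n k : ℕ} (π : Equiv.Perm (Fin n)) (σ : Equiv.Perm (Fin k)) : Prop :=
  ∃ i : Fin k ↪o Fin n, ∀ s t : Fin k, π (i s) < π (i t) ↔ σ s < σ t

/-- The involutions of length `n` that avoid the pattern `β` (the identity counts as an
involution). -/
def avoidingInvolutions {k : ℕ} (β : Equiv.Perm (Fin k)) (n : ℕ) : Set (Equiv.Perm (Fin n)) :=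
  {π | Function.Involutive π ∧ ¬ ContainsPattern π β}

/-- The pattern `1342` in one-line notation, with values numbered from `0`. -/
def pattern1342 : Equiv.Perm (Fin 4) where
  toFun := ![0, 2, 3, 1]
  invFun := ![0, 3, 1, 2]
  left_inv := by unfold Function.LeftInverse; decide
  right_inv := by unfold Function.RightInverse Function.LeftInverse; decide

/-- The generating function by length, `∑_{n ≥ 1} |C_n| x ^ n`, of a set of permutations whose
members of length `n` form `C n`. The empty permutation is not counted. -/
noncomputable def lengthGeneratingFunction (C : ∀ n : ℕ, Set (Equiv.Perm (Fin n))) :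
    PowerSeries ℚ :=
  PowerSeries.mk fun n => if n = 0 then 0 else ((C n).ncard : ℚ)

/-- `C` has proper growth rate `r`: the `n`-th roots of `|C_n|` converge to `r`, that is, their
upper and lower limits are both equal to `r`. -/
def HasGrowthRate (C : ∀ n : ℕ, Set (Equiv.Perm (Fin n))) (r : ℝ) : Prop :=
  Tendsto (fun n : ℕ => ((C n).ncard : ℝ) ^ (1 / (n : ℝ))) atTop (𝓝 r)

/-! Delete the cycle of 0. If 0 is fixed, it plays the 1 of 1342, so the rest has no 231 and, by
inversion, no 312. If 0 is exchanged with `c + 1`, the same ban falls on the remaining entries from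
index `c` on. Hence the refined count by `LayeredFrom`. After insertion, being layered from `m + 1`
is automatic for `c ≤ m`; for `c > m` the smaller involution must be layered from `m`, and it then
determines `c`. This gives the recurrence `layeredCount_add_two`.

In terms of the tail length `t = n - m`, differencing removes the sum and leaves a second-order
linear recurrence in `t` for generating functions. A particular solution brings in the denominator
`1 - 3x + x²`; divisibility of the `t`-th series by `X ^ t` excludes one characteristic root and so
determines the series at `t = 1`.

The growth rate comes from the counts directly: `(1 + φ) ^ k * 2 ^ (n - k)` nearly solves the
recurrence and bounds them on both sides, up to a factor and a correction. -/

/-- The one-line notation of `π` has no `231` and no `312` at positions `≥ m`. -/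
def LayeredFrom {n : ℕ} (π : Equiv.Perm (Fin n)) (m : ℕ) : Prop :=
  ∀ a b c : Fin n, m ≤ (a : ℕ) → a < b → b < c →
    ¬ (π c < π a ∧ π a < π b) ∧ ¬ (π b < π c ∧ π c < π a)

theorem LayeredFrom.mono {n : ℕ} {π : Equiv.Perm (Fin n)} {m k : ℕ} (h : LayeredFrom π m)
    (hmk : m ≤ k) : LayeredFrom π k :=
  fun a b c ha => h a b c (hmk.trans ha)

theorem layeredFrom_of_le_add_two {n : ℕ} (π : Equiv.Perm (Fin n)) {m : ℕ} (h : n ≤ m + 2) :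
    LayeredFrom π m := by
  intro a b c ha hab hbc
  have := c.isLt
  rw [Fin.lt_def] at hab hbc
  omega

theorem containsPattern_pattern1342_iff {n : ℕ} (π : Equiv.Perm (Fin n)) :
    ContainsPattern π pattern1342 ↔
      ∃ a b c d, a < b ∧ b < c ∧ c < d ∧ π a < π d ∧ π d < π b ∧ π b < π c := by
  constructor
  · rintro ⟨i, hi⟩
    refine ⟨i 0, i 1, i 2, i 3, i.lt_iff_lt.2 (by decide), i.lt_iff_lt.2 (by decide),
      i.lt_iff_lt.2 (by decide), (hi _ _).2 (by decide), (hi _ _).2 (by decide),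
      (hi _ _).2 (by decide)⟩
  · rintro ⟨a, b, c, d, hab, hbc, hcd, had, hdb, hbc'⟩
    have hmono : StrictMono ![a, b, c, d] := by
      rw [Fin.strictMono_iff_lt_succ]
      intro j
      fin_cases j <;> assumption
    refine ⟨OrderEmbedding.ofStrictMono _ hmono, fun s t => ?_⟩
    rw [OrderEmbedding.coe_ofStrictMono]
    have h1 := had.trans hdb
    have h2 := hdb.trans hbc'
    have h3 := h1.trans hbc'
    fin_cases s <;> fin_cases t <;>
      simp [pattern1342, *, lt_asymm]

theorem mem_avoidingInvolutions_iff {n : ℕ} (π : Equiv.Perm (Fin n)) :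
    π ∈ avoidingInvolutions pattern1342 n ↔ Function.Involutive π ∧
      ∀ a b c d, a < b → b < c → c < d → ¬ (π a < π d ∧ π d < π b ∧ π b < π c) := by
  rw [avoidingInvolutions, Set.mem_ofPred_eq, containsPattern_pattern1342_iff]
  refine and_congr_right fun _ => ?_
  push Not
  rfl

/-! ### Inserting a 2-cycle through 0 -/

/-- The order embedding of `Fin n` into `Fin (n + 2)` that skips `0` and `c.succ`. -/
def skipTwo {n : ℕ} (c : Fin (n + 1)) (v : Fin n) : Fin (n + 2) := (c.succAbove v).succ

section skipTwo

variable {n : ℕ} (c : Fin (n + 1)) (v w : Fin n)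

theorem skipTwo_lt_skipTwo : skipTwo c v < skipTwo c w ↔ v < w := by
  simp [skipTwo, Fin.succAbove_lt_succAbove_iff]

theorem skipTwo_injective : Function.Injective (skipTwo c) := by
  intro v w h
  simpa [skipTwo] using h

theorem zero_lt_skipTwo : 0 < skipTwo c v := Fin.succ_pos _

theorem val_skipTwo : (skipTwo c v : ℕ) = if (v : ℕ) < c then (v : ℕ) + 1 else (v : ℕ) + 2 := by
  simp only [skipTwo, Fin.succAbove, Fin.lt_def]
  split_ifs <;> simp_all

theorem skipTwo_lt_succ : skipTwo c v < c.succ ↔ (v : ℕ) < c := by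
  rw [Fin.lt_def, val_skipTwo, Fin.val_succ]
  split_ifs <;> omega

theorem succ_lt_skipTwo : c.succ < skipTwo c v ↔ (c : ℕ) ≤ v := by
  rw [Fin.lt_def, val_skipTwo, Fin.val_succ]
  split_ifs <;> omega

theorem eq_skipTwo_of_ne {x : Fin (n + 2)} (h0 : x ≠ 0) (hc : x ≠ c.succ) :
    ∃ v, x = skipTwo c v := by
  obtain ⟨y, rfl⟩ := Fin.exists_succ_eq.2 h0
  obtain ⟨v, rfl⟩ := Fin.exists_succAbove_eq (x := y) (y := c) (by simpa using hc)
  exact ⟨v, rfl⟩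

/-- The permutation that exchanges `0` and `c.succ` and acts as `σ` on the other points. -/
def insertCycle (σ : Equiv.Perm (Fin n)) : Equiv.Perm (Fin (n + 2)) where
  toFun := Fin.cons c.succ (c.insertNth 0 fun v => skipTwo c (σ v))
  invFun := Fin.cons c.succ (c.insertNth 0 fun v => skipTwo c (σ.symm v))
  left_inv x := by
    by_cases h0 : x = 0
    · subst h0; simp
    · by_cases hc : x = c.succ
      · subst hc; simp
      · obtain ⟨v, rfl⟩ := eq_skipTwo_of_ne c h0 hc
        simp [skipTwo]
  right_inv x := by
    by_cases h0 : x = 0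
    · subst h0; simp
    · by_cases hc : x = c.succ
      · subst hc; simp
      · obtain ⟨v, rfl⟩ := eq_skipTwo_of_ne c h0 hc
        simp [skipTwo]

variable (σ : Equiv.Perm (Fin n))

@[simp] theorem insertCycle_zero : insertCycle c σ 0 = c.succ := by simp [insertCycle]

@[simp] theorem insertCycle_succ : insertCycle c σ c.succ = 0 := by simp [insertCycle]

@[simp] theorem insertCycle_skipTwo : insertCycle c σ (skipTwo c v) = skipTwo c (σ v) := by
  simp [insertCycle, skipTwo]

end skipTwo

theorem insertCycle_injective {n : ℕ} :
    Function.Injective fun p : Fin (n + 1) × Equiv.Perm (Fin n) => insertCycle p.1 p.2 := by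
  rintro ⟨c, σ⟩ ⟨d, ρ⟩ h
  simp only at h
  have hcd : c = d := by
    have := congrArg (fun f => f 0) h
    simpa using this
  subst hcd
  refine Prod.ext rfl (Equiv.ext fun v => skipTwo_injective c ?_)
  simpa using congrArg (fun f => f (skipTwo c v)) h

theorem involutive_insertCycle_iff {n : ℕ} (c : Fin (n + 1)) (σ : Equiv.Perm (Fin n)) :
    Function.Involutive (insertCycle c σ) ↔ Function.Involutive σ := by
  constructor
  · intro h v
    have := h (skipTwo c v)
    simpa using skipTwo_injective c (by simpa using this)
  · intro h x
    by_cases h0 : x = 0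
    · subst h0; simp
    · by_cases hc : x = c.succ
      · subst hc; simp
      · obtain ⟨v, rfl⟩ := eq_skipTwo_of_ne c h0 hc
        simp [h v]

theorem exists_insertCycle_eq {n : ℕ} {τ : Equiv.Perm (Fin (n + 2))} (hτ : Function.Involutive τ)
    (h0 : τ 0 ≠ 0) : ∃ c σ, insertCycle c σ = τ := by
  obtain ⟨c, hc⟩ := Fin.exists_succ_eq.2 h0
  have hc0 : τ c.succ = 0 := by rw [hc, hτ]
  have key : ∀ v, ∃ w, τ (skipTwo c v) = skipTwo c w := fun v => by
    apply eq_skipTwo_of_ne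
    · rw [← hc0, τ.injective.ne_iff]
      intro h
      have := (skipTwo_lt_succ c v).not.1 (by simp [h])
      exact absurd ((succ_lt_skipTwo c v).2 (not_lt.1 this)) (by simp [h])
    · rw [hc, τ.injective.ne_iff]
      exact (zero_lt_skipTwo c v).ne'
  choose f hf using key
  have hf2 : Function.Involutive f := fun v => skipTwo_injective c (by rw [← hf, ← hf, hτ])
  refine ⟨c, hf2.toPerm f, Equiv.ext fun x => ?_⟩
  by_cases hx0 : x = 0
  · subst hx0; simp [hc]
  · by_cases hxc : x = c.succ
    · subst hxc; simp [hc0]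
    · obtain ⟨v, rfl⟩ := eq_skipTwo_of_ne c hx0 hxc
      simp [hf]

/-- The value 0 at position `c + 1` is the 1 of a 1342 for any later 231. The entry `c + 1` at
position 0 does the same for a 231 in larger values, which inversion turns into a 312 at positions
from `c` on. -/
theorem insertCycle_mem_avoidingInvolutions_iff {n : ℕ} (c : Fin (n + 1))
    (σ : Equiv.Perm (Fin n)) :
    insertCycle c σ ∈ avoidingInvolutions pattern1342 (n + 2) ↔
      σ ∈ avoidingInvolutions pattern1342 n ∧ LayeredFrom σ c := by
  rw [mem_avoidingInvolutions_iff, mem_avoidingInvolutions_iff, involutive_insertCycle_iff,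
    and_assoc]
  refine and_congr_right fun hσ => ⟨fun h => ⟨?_, ?_⟩, ?_⟩
  · intro x y z w hxy hyz hzw
    simpa [skipTwo_lt_skipTwo] using h (skipTwo c x) (skipTwo c y) (skipTwo c z) (skipTwo c w)
      ((skipTwo_lt_skipTwo ..).2 hxy) ((skipTwo_lt_skipTwo ..).2 hyz)
      ((skipTwo_lt_skipTwo ..).2 hzw)
  · intro x y z hx hxy hyz
    constructor
    · simpa [skipTwo_lt_skipTwo, zero_lt_skipTwo] using
        h c.succ (skipTwo c x) (skipTwo c y) (skipTwo c z)
          ((succ_lt_skipTwo ..).2 hx) ((skipTwo_lt_skipTwo ..).2 hxy)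
          ((skipTwo_lt_skipTwo ..).2 hyz)
    · rintro ⟨h1, h2⟩
      have := h 0 (skipTwo c (σ y)) (skipTwo c (σ z)) (skipTwo c (σ x)) (zero_lt_skipTwo ..)
        ((skipTwo_lt_skipTwo ..).2 h1) ((skipTwo_lt_skipTwo ..).2 h2)
      simp [skipTwo_lt_skipTwo, succ_lt_skipTwo, hσ x, hσ y, hσ z, hx, hxy, hyz] at this
  · rintro ⟨hA, hL⟩ x y z w hxy hyz hzw ⟨h1, h2, h3⟩
    -- The 1 of the pattern precedes and lies below the other three entries, so these avoid position
    -- 0 and value 0.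
    have aux : ∀ u, x < u → insertCycle c σ x < insertCycle c σ u → ∃ v, u = skipTwo c v := by
      intro u hu hu'
      apply eq_skipTwo_of_ne
      · rintro rfl
        exact Fin.not_lt_zero _ hu
      · rintro rfl
        simp at hu'
    obtain ⟨w, rfl⟩ := aux w (hxy.trans (hyz.trans hzw)) h1
    obtain ⟨y, rfl⟩ := aux y hxy (h1.trans h2)
    obtain ⟨z, rfl⟩ := aux z (hxy.trans hyz) (h1.trans (h2.trans h3))
    simp only [insertCycle_skipTwo, skipTwo_lt_skipTwo] at h2 h3 hyz hzw
    by_cases hx0 : x = 0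
    · subst hx0
      simp only [insertCycle_zero, insertCycle_skipTwo, succ_lt_skipTwo] at h1
      exact (hL _ _ _ h1 h2 h3).2 (by simpa [hσ y, hσ z, hσ w] using ⟨hyz, hzw⟩)
    · by_cases hxc : x = c.succ
      · subst hxc
        rw [succ_lt_skipTwo] at hxy
        exact (hL _ _ _ hxy hyz hzw).1 ⟨h2, h3⟩
      · obtain ⟨x, rfl⟩ := eq_skipTwo_of_ne c hx0 hxc
        simp only [insertCycle_skipTwo, skipTwo_lt_skipTwo] at h1 hxy
        exact hA x y z w hxy hyz hzw ⟨h1, h2, h3⟩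

/-- The values of `σ` at the points above `m` that are `≥ c` lie above `σ m`, the others below. -/
def SplitsAt {n : ℕ} (σ : Equiv.Perm (Fin n)) (m : Fin n) (c : ℕ) : Prop :=
  ∀ v : Fin n, m < v → (c ≤ (v : ℕ) ↔ σ m < σ v)

/-- What matters is where the value 0, at position `c + 1`, falls in the window from `m + 1`. For `c
≤ m` it is at most the first entry there and, being minimal, starts no 231 or 312. For `m < c`, an
entry before it must exceed those between it and the 0 and lie below those after. This split at `m`,
with layeredness, yields the split at later entries. -/
theorem layeredFrom_insertCycle_iff {n : ℕ} (c : Fin (n + 1)) {σ : Equiv.Perm (Fin n)}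
    (hσ : LayeredFrom σ c) (m : Fin n) :
    LayeredFrom (insertCycle c σ) (m + 1) ↔
      (c : ℕ) ≤ m ∨ ((m : ℕ) < c ∧ LayeredFrom σ m ∧ SplitsAt σ m c) := by
  have hle : ∀ v : Fin n, m ≤ v → (m : ℕ) + 1 ≤ skipTwo c v := fun v hv => by
    rw [Fin.le_def] at hv
    rw [val_skipTwo]
    split_ifs
    all_goals omega
  have hc0 : ∀ u v, insertCycle c σ u < insertCycle c σ v → v ≠ c.succ := by
    rintro u v h rfl
    simp at h
  have hpos : ∀ {u : Fin (n + 2)}, (m : ℕ) + 1 ≤ u → u ≠ 0 := by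
    rintro u h rfl
    simp at h
  constructor
  · intro h
    refine or_iff_not_imp_left.2 fun hcm => ?_
    rw [not_le] at hcm
    have hLm : LayeredFrom σ m := by
      intro x y z hx hxy hyz
      simpa [skipTwo_lt_skipTwo] using h (skipTwo c x) (skipTwo c y) (skipTwo c z) (hle x hx)
        ((skipTwo_lt_skipTwo ..).2 hxy) ((skipTwo_lt_skipTwo ..).2 hyz)
    refine ⟨hcm, hLm, fun v hv => ⟨fun hcv => ?_, fun hmv => ?_⟩⟩
    · have := (h (skipTwo c m) c.succ (skipTwo c v) (hle m le_rfl) ((skipTwo_lt_succ ..).2 hcm)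
        ((succ_lt_skipTwo ..).2 hcv)).2
      simp only [insertCycle_succ, insertCycle_skipTwo, zero_lt_skipTwo, skipTwo_lt_skipTwo,
        true_and, not_lt] at this
      exact lt_of_le_of_ne this (σ.injective.ne hv.ne)
    · by_contra hcv
      have := (h (skipTwo c m) (skipTwo c v) c.succ (hle m le_rfl) ((skipTwo_lt_skipTwo ..).2 hv)
        ((skipTwo_lt_succ ..).2 (not_le.1 hcv))).1
      simp [zero_lt_skipTwo, skipTwo_lt_skipTwo, hmv] at this
  · intro h x y z hx hxy hyz
    have hy : (m : ℕ) + 1 ≤ y := hx.trans (Fin.le_def.1 hxy.le)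
    have hz : (m : ℕ) + 1 ≤ z := hy.trans (Fin.le_def.1 hyz.le)
    have old : ∀ x y z : Fin n, (m : ℕ) + 1 ≤ skipTwo c x → x < y → y < z →
        ¬ (σ z < σ x ∧ σ x < σ y) ∧ ¬ (σ y < σ z ∧ σ z < σ x) := by
      intro x y z hx hxy hyz
      rw [val_skipTwo] at hx
      rcases h with h | ⟨h, hL, -⟩
      · exact hσ x y z (by split_ifs at hx <;> omega) hxy hyz
      · exact hL x y z (by split_ifs at hx <;> omega) hxy hyz
    have hxc : ∀ u, insertCycle c σ u < insertCycle c σ x → ∃ v, x = skipTwo c v :=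
      fun u hu => eq_skipTwo_of_ne c (hpos hx) (hc0 _ _ hu)
    have hle' : ∀ v : Fin n, (m : ℕ) < c → (m : ℕ) + 1 ≤ skipTwo c v → m = v ∨ m < v := by
      intro v hmc hv
      rw [val_skipTwo] at hv
      refine eq_or_lt_of_le ?_
      rw [Fin.le_def]
      split_ifs at hv <;> omega
    constructor
    · rintro ⟨h1, h2⟩
      obtain ⟨x, rfl⟩ := hxc z h1
      obtain ⟨y, rfl⟩ := eq_skipTwo_of_ne c (hpos hy) (hc0 _ _ h2)
      rw [skipTwo_lt_skipTwo] at hxy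
      rw [insertCycle_skipTwo, insertCycle_skipTwo, skipTwo_lt_skipTwo] at h2
      by_cases hzc : z = c.succ
      · subst hzc
        rw [skipTwo_lt_succ] at hyz
        rcases h with h | ⟨hmc, hL, hS⟩
        · rw [Fin.lt_def] at hxy
          rw [val_skipTwo] at hx
          split_ifs at hx
          all_goals omega
        · have hmy : m < y := by
            rcases hle' x hmc hx with rfl | hmx
            exacts [hxy, hmx.trans hxy]
          have hym := (hS y hmy).not.1 (not_le.2 hyz)
          rcases hle' x hmc hx with rfl | hmx
          · exact hym h2
          · exact (hL m x y le_rfl hmx hxy).2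
              ⟨h2, lt_of_le_of_ne (not_lt.1 hym) (σ.injective.ne hmy.ne')⟩
      · obtain ⟨z, rfl⟩ := eq_skipTwo_of_ne c (hpos hz) hzc
        simp only [insertCycle_skipTwo, skipTwo_lt_skipTwo] at h1 hyz
        exact (old x y z hx hxy hyz).1 ⟨h1, h2⟩
    · rintro ⟨h1, h2⟩
      obtain ⟨x, rfl⟩ := hxc z h2
      obtain ⟨z, rfl⟩ := eq_skipTwo_of_ne c (hpos hz) (hc0 _ _ h1)
      rw [insertCycle_skipTwo, insertCycle_skipTwo, skipTwo_lt_skipTwo] at h2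
      by_cases hyc : y = c.succ
      · subst hyc
        rw [succ_lt_skipTwo] at hyz
        rw [skipTwo_lt_succ] at hxy
        rcases h with h | ⟨hmc, hL, hS⟩
        · rw [val_skipTwo] at hx
          split_ifs at hx
          all_goals omega
        · have hmz := (hS z (Fin.lt_def.2 (hmc.trans_le hyz))).1 hyz
          rcases hle' x hmc hx with rfl | hmx
          · exact hmz.not_gt h2
          · exact (hS x hmx).not.1 (not_le.2 hxy) (hmz.trans h2)
      · obtain ⟨y, rfl⟩ := eq_skipTwo_of_ne c (hpos hy) hyc
        simp only [insertCycle_skipTwo, skipTwo_lt_skipTwo] at h1 hyz hxy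
        exact (old x y z hx hxy hyz).2 ⟨h1, h2⟩

/-- With no 231 starting at `m`, the later entries below `σ m` precede those above it; `c` is where
the latter begin. -/
theorem existsUnique_splitsAt {n : ℕ} {σ : Equiv.Perm (Fin n)} {m : Fin n}
    (h : LayeredFrom σ m) : ∃! c : Fin (n + 1), (m : ℕ) < c ∧ SplitsAt σ m c := by
  classical
  -- At `k = n` the condition is vacuous: this is the cut when no later entry exceeds `σ m`.
  have hex : ∃ k, (m : ℕ) < k ∧ ∀ v : Fin n, (v : ℕ) = k → σ m < σ v :=
    ⟨n, m.isLt, fun v hv => absurd hv v.isLt.ne⟩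
  obtain ⟨h1, h2⟩ := Nat.find_spec hex
  have hlt : Nat.find hex < n + 1 :=
    Nat.lt_succ_of_le (Nat.find_min' hex ⟨m.isLt, fun v hv => absurd hv v.isLt.ne⟩)
  refine ⟨⟨Nat.find hex, hlt⟩, ⟨h1, fun v hv => ⟨fun hcv => ?_, fun hmv => ?_⟩⟩, ?_⟩
  · rcases eq_or_lt_of_le hcv with hcv | hcv
    · exact h2 v hcv.symm
    · by_contra hvm
      have hvm' : σ v < σ m := lt_of_le_of_ne (not_lt.1 hvm) (σ.injective.ne hv.ne')
      simp only at hcv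
      exact (h m ⟨Nat.find hex, hcv.trans v.isLt⟩ v le_rfl (Fin.lt_def.2 h1)
        (Fin.lt_def.2 hcv)).1 ⟨hvm', h2 _ rfl⟩
  · refine Nat.find_min' hex ⟨Fin.lt_def.1 hv, fun w hw => ?_⟩
    rwa [Fin.ext hw]
  · rintro ⟨d, hd⟩ ⟨hmd, hS⟩
    simp only at hmd hS
    rw [Fin.mk.injEq]
    apply le_antisymm
    · by_contra! hlt'
      have hn : Nat.find hex < n := by omega
      have := (hS ⟨_, hn⟩ (Fin.lt_def.2 h1)).2 (h2 _ rfl)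
      simp only at this
      omega
    · exact Nat.find_min' hex ⟨hmd, fun v hv => (hS v (Fin.lt_def.2 (hv ▸ hmd))).1 hv.ge⟩

/-! ### Inserting a fixed point at 0 -/

/-- The permutation that fixes `0` and acts as `σ` on the other points. -/
def insertFixed {n : ℕ} (σ : Equiv.Perm (Fin n)) : Equiv.Perm (Fin (n + 1)) :=
  Equiv.Perm.decomposeFin.symm (0, σ)

section insertFixed

variable {n : ℕ} (σ : Equiv.Perm (Fin n))

@[simp] theorem insertFixed_zero : insertFixed σ 0 = 0 := by simp [insertFixed]

@[simp] theorem insertFixed_succ (v : Fin n) : insertFixed σ v.succ = (σ v).succ := by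
  simp [insertFixed]

theorem insertFixed_injective : Function.Injective (insertFixed (n := n)) := by
  intro σ ρ h
  simpa [insertFixed] using h

theorem involutive_insertFixed_iff :
    Function.Involutive (insertFixed σ) ↔ Function.Involutive σ := by
  constructor
  · intro h v
    simpa using h v.succ
  · intro h x
    cases x using Fin.cases with
    | zero => simp
    | succ v => simp [h v]

theorem exists_insertFixed_eq {τ : Equiv.Perm (Fin (n + 1))} (h0 : τ 0 = 0) :
    ∃ σ, insertFixed σ = τ := by
  obtain ⟨⟨p, σ⟩, rfl⟩ := Equiv.Perm.decomposeFin.symm.surjective τ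
  rw [Equiv.Perm.decomposeFin_symm_apply_zero] at h0
  exact ⟨σ, by rw [insertFixed, h0]⟩

theorem layeredFrom_insertFixed {σ : Equiv.Perm (Fin n)} (h : LayeredFrom σ 0) (m : ℕ) :
    LayeredFrom (insertFixed σ) m := by
  intro x y z _ hxy hyz
  obtain ⟨y, rfl⟩ := Fin.exists_succ_eq.2 (Fin.ne_zero_of_lt hxy)
  obtain ⟨z, rfl⟩ := Fin.exists_succ_eq.2 (Fin.ne_zero_of_lt hyz)
  cases x using Fin.cases with
  | zero => simp
  | succ x =>
    simp only [insertFixed_succ, Fin.succ_lt_succ_iff] at hxy hyz ⊢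
    exact h x y z (Nat.zero_le _) hxy hyz

theorem mem_avoidingInvolutions_of_layeredFrom_zero {σ : Equiv.Perm (Fin n)}
    (hσ : Function.Involutive σ) (h : LayeredFrom σ 0) :
    σ ∈ avoidingInvolutions pattern1342 n :=
  (mem_avoidingInvolutions_iff σ).2 ⟨hσ, fun _ b c d _ hbc hcd H =>
    (h b c d (Nat.zero_le _) hbc hcd).1 ⟨H.2.1, H.2.2⟩⟩

theorem insertFixed_mem_avoidingInvolutions_iff :
    insertFixed σ ∈ avoidingInvolutions pattern1342 (n + 1) ↔
      σ ∈ avoidingInvolutions pattern1342 n ∧ LayeredFrom σ 0 := by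
  constructor
  · rw [mem_avoidingInvolutions_iff, involutive_insertFixed_iff]
    rintro ⟨hσ, h⟩
    have h231 : ∀ x y z, x < y → y < z → ¬ (σ z < σ x ∧ σ x < σ y) := by
      intro x y z hxy hyz
      simpa [Fin.succ_lt_succ_iff] using h 0 x.succ y.succ z.succ (Fin.succ_pos _)
        (Fin.succ_lt_succ_iff.2 hxy) (Fin.succ_lt_succ_iff.2 hyz)
    have hL : LayeredFrom σ 0 := by
      intro x y z _ hxy hyz
      refine ⟨h231 x y z hxy hyz, fun ⟨h1, h2⟩ => h231 _ _ _ h1 h2 ?_⟩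
      simpa [hσ x, hσ y, hσ z] using ⟨hxy, hyz⟩
    exact ⟨mem_avoidingInvolutions_of_layeredFrom_zero hσ hL, hL⟩
  · rintro ⟨h, hL⟩
    rw [mem_avoidingInvolutions_iff] at h
    exact mem_avoidingInvolutions_of_layeredFrom_zero ((involutive_insertFixed_iff σ).2 h.1)
      (layeredFrom_insertFixed hL 0)

end insertFixed

/-! ### The counting recurrence and its boundary values -/

/-- The number of `1342`-avoiding involutions of length `n` that are layered from position `m`. -/
noncomputable def layeredCount (n m : ℕ) : ℕ :=
  {π | π ∈ avoidingInvolutions pattern1342 n ∧ LayeredFrom π m}.ncard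

theorem layeredCount_of_le_add_two {n m : ℕ} (h : n ≤ m + 2) :
    layeredCount n m = (avoidingInvolutions pattern1342 n).ncard := by
  simp [layeredCount, layeredFrom_of_le_add_two _ h]

theorem Set.ncard_eq_sum_ncard_fiber {α : Type*} [Finite α] (S : Set α) (f : α → ℕ) (N : ℕ)
    (h : ∀ x ∈ S, f x < N) : S.ncard = ∑ i ∈ Finset.range N, {x ∈ S | f x = i}.ncard := by
  classical
  have := Fintype.ofFinite α
  rw [Set.ncard_eq_toFinset_card' S, Finset.card_eq_sum_card_fiberwise (f := f)
    (t := Finset.range N) (fun x hx => by simpa using h x (by simpa using hx))]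
  refine Finset.sum_congr rfl fun i _ => ?_
  rw [Set.ncard_eq_toFinset_card']
  congr 1
  ext x
  simp

theorem setOf_layeredFrom_eq_union {n : ℕ} (m : Fin n) :
    {τ | τ ∈ avoidingInvolutions pattern1342 (n + 2) ∧ LayeredFrom τ (m + 1)} =
      (insertFixed '' {σ | σ ∈ avoidingInvolutions pattern1342 (n + 1) ∧ LayeredFrom σ 0}) ∪
      (fun p : Fin (n + 1) × Equiv.Perm (Fin n) => insertCycle p.1 p.2) ''
        ({p | (p.1 : ℕ) ≤ m ∧ p.2 ∈ avoidingInvolutions pattern1342 n ∧ LayeredFrom p.2 p.1} ∪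
        {p | ((m : ℕ) < p.1 ∧ SplitsAt p.2 m p.1) ∧
          p.2 ∈ avoidingInvolutions pattern1342 n ∧ LayeredFrom p.2 m}) := by
  ext τ
  simp only [Set.mem_union, Set.mem_image, Set.mem_ofPred_eq, Prod.exists]
  constructor
  · rintro ⟨hτ, hL⟩
    by_cases h0 : τ 0 = 0
    · obtain ⟨σ, rfl⟩ := exists_insertFixed_eq h0
      exact Or.inl ⟨σ, (insertFixed_mem_avoidingInvolutions_iff σ).1 hτ, rfl⟩
    · obtain ⟨c, σ, rfl⟩ :=
        exists_insertCycle_eq ((mem_avoidingInvolutions_iff τ).1 hτ).1 h0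
      obtain ⟨hσ, hc⟩ := (insertCycle_mem_avoidingInvolutions_iff c σ).1 hτ
      refine Or.inr ⟨c, σ, ?_, rfl⟩
      rcases (layeredFrom_insertCycle_iff c hc m).1 hL with h | ⟨h, hm, hS⟩
      exacts [Or.inl ⟨h, hσ, hc⟩, Or.inr ⟨⟨h, hS⟩, hσ, hm⟩]
  · rintro (⟨σ, ⟨hσ, hL⟩, rfl⟩ | ⟨c, σ, ⟨h, hσ, hc⟩ | ⟨⟨h, hS⟩, hσ, hm⟩, rfl⟩)
    · exact ⟨(insertFixed_mem_avoidingInvolutions_iff σ).2 ⟨hσ, hL⟩, layeredFrom_insertFixed hL _⟩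
    · exact ⟨(insertCycle_mem_avoidingInvolutions_iff c σ).2 ⟨hσ, hc⟩,
        (layeredFrom_insertCycle_iff c hc m).2 (Or.inl h)⟩
    · have hc := hm.mono h.le
      exact ⟨(insertCycle_mem_avoidingInvolutions_iff c σ).2 ⟨hσ, hc⟩,
        (layeredFrom_insertCycle_iff c hc m).2 (Or.inr ⟨h, hm, hS⟩)⟩

theorem ncard_insertCycle_le {n : ℕ} (m : Fin n) :
    {p : Fin (n + 1) × Equiv.Perm (Fin n) | (p.1 : ℕ) ≤ m ∧
      p.2 ∈ avoidingInvolutions pattern1342 n ∧ LayeredFrom p.2 p.1}.ncard =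
      ∑ i ∈ Finset.range (m + 1), layeredCount n i := by
  rw [Set.ncard_eq_sum_ncard_fiber _ (fun p => (p.1 : ℕ)) (m + 1)
    (fun p hp => Nat.lt_succ_of_le hp.1)]
  refine Finset.sum_congr rfl fun i hi => ?_
  have hi' : i ≤ m := Nat.le_of_lt_succ (Finset.mem_range.1 hi)
  have hin : i < n + 1 := by omega
  rw [layeredCount, ← Set.ncard_image_of_injective
    {σ | σ ∈ avoidingInvolutions pattern1342 n ∧ LayeredFrom σ i}
    (Prod.mk_right_injective (⟨i, hin⟩ : Fin (n + 1)))]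
  refine congrArg Set.ncard ?_
  ext ⟨c, σ⟩
  simp only [Set.mem_ofPred_eq, Set.mem_image, Prod.mk.injEq]
  constructor
  · rintro ⟨⟨_, h⟩, rfl⟩
    exact ⟨σ, h, rfl, rfl⟩
  · rintro ⟨σ, h, rfl, rfl⟩
    exact ⟨⟨hi', h⟩, rfl⟩

theorem ncard_insertCycle_gt {n : ℕ} (m : Fin n) :
    {p : Fin (n + 1) × Equiv.Perm (Fin n) | ((m : ℕ) < p.1 ∧ SplitsAt p.2 m p.1) ∧
      p.2 ∈ avoidingInvolutions pattern1342 n ∧ LayeredFrom p.2 m}.ncard = layeredCount n m := by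
  rw [layeredCount, ← Set.InjOn.ncard_image (f := Prod.snd)]
  · congr 1
    ext σ
    simp only [Set.mem_ofPred_eq, Set.mem_image, Prod.exists]
    constructor
    · rintro ⟨c, σ, ⟨_, h⟩, rfl⟩
      exact h
    · intro h
      obtain ⟨c, hc⟩ := (existsUnique_splitsAt h.2).exists
      exact ⟨c, σ, ⟨hc, h⟩, rfl⟩
  · rintro ⟨c, σ⟩ ⟨hc, h⟩ ⟨d, ρ⟩ ⟨hd, _⟩ (rfl : σ = ρ)
    exact Prod.ext ((existsUnique_splitsAt h.2).unique hc hd) rfl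

/-- The terms count 0 fixed, 0 exchanged with `c + 1` for `c = i ≤ m`, and the same for `c > m`,
where `c` is forced. -/
theorem layeredCount_add_two {n m : ℕ} (hm : m < n) :
    layeredCount (n + 2) (m + 1) = layeredCount (n + 1) 0 +
      ∑ i ∈ Finset.range (m + 1), layeredCount n i + layeredCount n m := by
  have key := setOf_layeredFrom_eq_union (⟨m, hm⟩ : Fin n)
  rw [layeredCount, key, Set.ncard_union_eq, Set.ncard_image_of_injective _ insertFixed_injective,
    Set.ncard_image_of_injective _ insertCycle_injective, Set.ncard_union_eq,
    ncard_insertCycle_le, ncard_insertCycle_gt, add_assoc]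
  · rfl
  · rw [Set.disjoint_left]
    rintro p ⟨h, _⟩ ⟨⟨h', _⟩, _⟩
    exact h.not_gt h'
  · rw [Set.disjoint_left]
    rintro _ ⟨σ, _, rfl⟩ ⟨⟨c, ρ⟩, _, h⟩
    have := congrArg (fun f => f 0) h
    simp at this

/-- A forbidden triple starting at position 0 yields one at positive positions, with the value 0 at
position `π 0` playing the 1. -/
theorem LayeredFrom.zero_of_one {n : ℕ} {π : Equiv.Perm (Fin n)} (hπ : Function.Involutive π)
    (h : LayeredFrom π 1) : LayeredFrom π 0 := by
  intro a b c _ hab hbc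
  have hn : 0 < n := a.pos
  have : NeZero n := ⟨hn.ne'⟩
  by_cases ha : a = 0
  swap
  · exact h a b c (Nat.one_le_iff_ne_zero.2 fun h0 => ha (Fin.ext (by simpa using h0))) hab hbc
  subst ha
  set k := π 0 with hk
  have hk0 : π k = 0 := hπ 0
  have h231 : ∀ x y z, 0 < x → x < y → y < z → ¬ (π z < π x ∧ π x < π y) :=
    fun x y z hx hxy hyz => (h x y z hx hxy hyz).1
  have h312 : ∀ x y z, 0 < x → x < y → y < z → ¬ (π y < π z ∧ π z < π x) :=
    fun x y z hx hxy hyz => (h x y z hx hxy hyz).2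
  have hpos : ∀ x, x ≠ k → 0 < π x := fun x hx =>
    Fin.pos_iff_ne_zero.2 fun h0 => hx (by rw [← hπ x, h0])
  have hc0 : 0 < c := hab.trans hbc
  -- a point beyond `k` whose value lies below `k` gives a `312` through the position `k`
  have cross : ∀ x, k < x → ¬ π x < k := fun x hx hx' => by
    have := h312 (π x) k x (hpos x hx.ne') hx' hx
    rw [hπ x, hk0] at this
    exact this ⟨hpos x hx.ne', hx'.trans hx⟩
  constructor
  · rintro ⟨h1, h2⟩
    rcases lt_trichotomy b k with hb | hb | hb
    · have := h312 b k (π b) hab hb h2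
      rw [hπ b, hk0] at this
      exact this ⟨hab, hb.trans h2⟩
    · rw [hb, hk0] at h2
      exact Fin.not_lt_zero _ h2
    · exact cross c (hb.trans hbc) h1
  · rintro ⟨h1, h2⟩
    rcases lt_trichotomy c k with hc | hc | hc
    · have := h231 b c k hab hbc hc
      rw [hk0] at this
      exact this ⟨hpos b (hbc.trans hc).ne, h1⟩
    · rw [hc, hk0] at h1
      exact Fin.not_lt_zero _ h1
    · exact cross c hc h2

theorem layeredCount_zero_right (n : ℕ) : layeredCount n 0 = layeredCount n 1 := by
  unfold layeredCount
  congr 1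
  ext π
  refine and_congr_right fun hπ => ⟨fun h => h.mono (Nat.zero_le 1), fun h => ?_⟩
  exact h.zero_of_one ((mem_avoidingInvolutions_iff π).1 hπ).1

theorem ncard_avoidingInvolutions_one : (avoidingInvolutions pattern1342 1).ncard = 1 := by
  rw [Set.ncard_eq_one]
  refine ⟨1, Set.eq_singleton_iff_unique_mem.2 ⟨?_, fun π _ => Subsingleton.elim _ _⟩⟩
  exact mem_avoidingInvolutions_of_layeredFrom_zero (fun x => rfl)
    (layeredFrom_of_le_add_two _ (by norm_num))

theorem ncard_avoidingInvolutions_two : (avoidingInvolutions pattern1342 2).ncard = 2 := by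
  have : avoidingInvolutions pattern1342 2 = Set.univ := by
    refine Set.eq_univ_of_forall fun π => ?_
    refine mem_avoidingInvolutions_of_layeredFrom_zero ?_ (layeredFrom_of_le_add_two _ le_rfl)
    unfold Function.Involutive
    revert π
    decide
  rw [this, Set.ncard_univ, Nat.card_eq_fintype_card, Fintype.card_perm]
  rfl

theorem layeredCount_succ_zero (n : ℕ) : layeredCount (n + 1) 0 = 2 ^ n := by
  induction n using Nat.strong_induction_on with
  | _ n ih =>
    match n with
    | 0 => rw [layeredCount_of_le_add_two (by norm_num), ncard_avoidingInvolutions_one, pow_zero]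
    | 1 => rw [layeredCount_of_le_add_two (by norm_num), ncard_avoidingInvolutions_two, pow_one]
    | n + 2 =>
      rw [layeredCount_zero_right, layeredCount_add_two (Nat.succ_pos n), ih (n + 1) (by omega),
        zero_add, Finset.sum_range_one, ih n (by omega)]
      ring

/-! ### Counting by tail length -/

/-- The number of `1342`-avoiding involutions of length `n` whose last `t` positions are layered,
where `t ≤ n`. -/
noncomputable def layeredTailCount (n t : ℕ) : ℕ :=
  if t ≤ n then layeredCount n (n - t) else 0

theorem layeredTailCount_of_lt {n t : ℕ} (h : n < t) : layeredTailCount n t = 0 :=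
  if_neg h.not_ge

theorem layeredTailCount_self (n : ℕ) : layeredTailCount (n + 1) (n + 1) = 2 ^ n := by
  rw [layeredTailCount, if_pos le_rfl, Nat.sub_self, layeredCount_succ_zero]

theorem layeredTailCount_succ_self (n : ℕ) : layeredTailCount (n + 2) (n + 1) = 2 ^ (n + 1) := by
  rw [layeredTailCount, if_pos (Nat.le_succ _), Nat.add_sub_add_left, ← layeredCount_zero_right,
    layeredCount_succ_zero]

theorem layeredTailCount_eq_ncard {n t : ℕ} (ht : t ≤ n) (ht2 : t ≤ 2) :
    layeredTailCount n t = (avoidingInvolutions pattern1342 n).ncard := by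
  rw [layeredTailCount, if_pos ht, layeredCount_of_le_add_two (by omega)]

/-- Subtracting consecutive instances of `layeredCount_add_two` cancels the term at position 0 and
all but one summand. -/
theorem layeredTailCount_add_two {n t : ℕ} (ht : 1 ≤ t) (htn : t < n) :
    layeredTailCount (n + 2) (t + 2) + 2 * layeredTailCount n t =
      layeredTailCount (n + 2) (t + 1) + layeredTailCount n (t + 1) := by
  obtain ⟨m, rfl⟩ := Nat.exists_eq_add_of_lt htn
  have h1 := layeredCount_add_two (n := t + m + 1) (m := m) (by omega)
  have h2 := layeredCount_add_two (n := t + m + 1) (m := m + 1) (by omega)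
  rw [Finset.sum_range_succ] at h2
  simp only [layeredTailCount]
  rw [if_pos (by omega), if_pos (by omega), if_pos (by omega), if_pos (by omega),
    show t + m + 1 + 2 - (t + 2) = m + 1 by omega, show t + m + 1 - t = m + 1 by omega,
    show t + m + 1 + 2 - (t + 1) = m + 1 + 1 by omega, show t + m + 1 - (t + 1) = m by omega]
  omega

/-- With the default 0 for `t > n`, corrections are needed only at `n + 1 = t` and `n = t`; they
become the inhomogeneous term of the series recurrence. -/
theorem cast_layeredTailCount_add_two (n : ℕ) {t : ℕ} (ht : 1 ≤ t) :
    (layeredTailCount (n + 2) (t + 2) : ℚ) =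
      layeredTailCount (n + 2) (t + 1) + layeredTailCount n (t + 1) - 2 * layeredTailCount n t
        - 2 ^ t * (if n + 2 = t + 1 then 1 else 0) + 2 ^ t * (if n + 2 = t + 2 then 1 else 0) := by
  obtain ⟨t, rfl⟩ := Nat.exists_eq_add_of_le' ht
  rcases lt_trichotomy (t + 1) n with h | rfl | h
  · rw [if_neg (by omega), if_neg (by omega)]
    have := layeredTailCount_add_two ht h
    qify at this
    linarith
  · rw [layeredTailCount_self, layeredTailCount_succ_self, layeredTailCount_self,
      layeredTailCount_of_lt (by omega), if_neg (by omega), if_pos rfl]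
    push_cast
    ring
  · rw [if_neg (c := n + 2 = t + 1 + 2) (by omega), layeredTailCount_of_lt (t := t + 1) h,
      layeredTailCount_of_lt (n := n) (t := t + 1 + 1) (by omega),
      layeredTailCount_of_lt (t := t + 1 + 2) (by omega)]
    split_ifs with h'
    · obtain rfl : n = t := by omega
      rw [layeredTailCount_self]
      simp
    · rw [layeredTailCount_of_lt (by omega)]
      simp

/-! ### The generating function -/

section GeneratingFunction

open PowerSeries

/-- The generating function of `layeredTailCount · t`. -/
noncomputable def layeredTailSeries (t : ℕ) : PowerSeries ℚ :=
  PowerSeries.mk fun n => (layeredTailCount n t : ℚ)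

theorem X_pow_dvd_layeredTailSeries (t : ℕ) : X ^ t ∣ layeredTailSeries t := by
  rw [X_pow_dvd_iff]
  intro m hm
  rw [layeredTailSeries, coeff_mk, layeredTailCount_of_lt hm, Nat.cast_zero]

theorem layeredTailSeries_one :
    layeredTailSeries 1 = lengthGeneratingFunction (avoidingInvolutions pattern1342) := by
  ext n
  rw [layeredTailSeries, lengthGeneratingFunction, coeff_mk, coeff_mk]
  split_ifs with h
  · rw [layeredTailCount_of_lt (by omega), Nat.cast_zero]
  · rw [layeredTailCount_eq_ncard (by omega) (by omega)]

theorem layeredTailSeries_two : layeredTailSeries 2 = layeredTailSeries 1 - X := by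
  ext n
  rw [layeredTailSeries, layeredTailSeries, map_sub, coeff_mk, coeff_mk, coeff_X]
  split_ifs with h
  · subst h
    rw [layeredTailCount_of_lt (by omega), layeredTailCount_self]
    simp
  · rcases Nat.eq_zero_or_pos n with rfl | hn
    · rw [layeredTailCount_of_lt (by omega), layeredTailCount_of_lt (by omega)]
      simp
    · rw [layeredTailCount_eq_ncard (by omega) le_rfl,
        layeredTailCount_eq_ncard (by omega) (by omega), sub_zero]

theorem layeredTailSeries_add_two {t : ℕ} (ht : 1 ≤ t) :
    layeredTailSeries (t + 2) = (1 + X ^ 2) * layeredTailSeries (t + 1)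
      - 2 * X ^ 2 * layeredTailSeries t - (2 * X) ^ t * (X * (1 - X)) := by
  have h : layeredTailSeries (t + 2) = layeredTailSeries (t + 1)
      + X ^ 2 * layeredTailSeries (t + 1) - X ^ 2 * (C (2 : ℚ) * layeredTailSeries t)
      - C ((2 : ℚ) ^ t) * X ^ (t + 1) + C ((2 : ℚ) ^ t) * X ^ (t + 2) := by
    ext n
    simp only [map_add, map_sub, coeff_X_pow_mul', coeff_C_mul, coeff_X_pow]
    simp only [layeredTailSeries, coeff_mk]
    match n with
    | 0 | 1 =>
      rw [layeredTailCount_of_lt (by omega), layeredTailCount_of_lt (by omega)]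
      simp [show t ≠ 0 by omega]
    | n + 2 =>
      rw [if_pos (by omega), if_pos (by omega), Nat.add_sub_cancel]
      exact cast_layeredTailCount_add_two n ht
  rw [h, map_pow, map_ofNat]
  ring

theorem exists_schroder_series :
    ∃ T : PowerSeries ℚ, T = 1 + X ^ 2 * T + X ^ 2 * T ^ 2 := by
  refine ⟨expand 2 two_ne_zero (PowerSeries.map (Nat.castRingHom ℚ) largeSchroderSeries), ?_⟩
  conv_lhs =>
    rw [largeSchroderSeries_eq_one_add_X_mul_largeSchroderSeries_add_X_mul_largeSchroderSeries_sq]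
  simp only [map_add, map_mul, map_one, map_pow, map_X, expand_X]

/-- Divisibility by `X ^ t` replaces a second initial condition: a component along the
characteristic root with constant term 1 would not gain powers of `X`. So `F 2 = l * F 1`, a linear
equation for the series sought. -/
theorem two_mul_lengthGeneratingFunction {R : PowerSeries ℚ} (hR0 : constantCoeff R = 1)
    (hR : R ^ 2 = 1 - 6 * X ^ 2 + X ^ 4) :
    lengthGeneratingFunction (avoidingInvolutions pattern1342) *
      (2 * (1 - 3 * X + X ^ 2)) = X * (1 - 2 * X + X ^ 2 + R) := by
  obtain ⟨l, hl⟩ : ∃ l : PowerSeries ℚ, l = C (1 / 2 : ℚ) * (1 + X ^ 2 - R) := ⟨_, rfl⟩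
  have h2 : (2 : PowerSeries ℚ) * C (1 / 2 : ℚ) = 1 := by
    rw [← map_ofNat (C (R := ℚ)) 2, ← map_mul]
    norm_num
  have hRl : R = 1 + X ^ 2 - 2 * l := by rw [hl]; linear_combination (1 + X ^ 2 - R) * h2
  have hl0 : constantCoeff l = 0 := by simp [hl, hR0]
  -- `l` and `1 + X ^ 2 - l` are the characteristic roots of the recurrence
  have hchar : l * (1 + X ^ 2 - l) = 2 * X ^ 2 := by
    have h4 : (4 : PowerSeries ℚ) ≠ 0 := by
      rw [← map_ofNat (C (R := ℚ)) 4]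
      simp
    apply mul_left_cancel₀ h4
    rw [hRl] at hR
    linear_combination -hR
  -- The quotient of `(1 - X) * (2 * X) ^ t` by `2 * (1 - 3 * X + X ^ 2)` is a particular solution;
  -- `F` is the homogeneous remainder, cleared of the denominator.
  obtain ⟨F, hF⟩ : ∃ F : ℕ → PowerSeries ℚ, ∀ t, F t =
      2 * (1 - 3 * X + X ^ 2) * layeredTailSeries t - (1 - X) * (2 * X) ^ t := ⟨_, fun _ => rfl⟩
  have hFrec : ∀ t, 1 ≤ t → F (t + 2) = (1 + X ^ 2) * F (t + 1) - 2 * X ^ 2 * F t := by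
    intro t ht
    rw [hF, hF, hF, layeredTailSeries_add_two ht]
    ring
  have hH : ∀ k, F (k + 2) - l * F (k + 1) = (1 + X ^ 2 - l) ^ k * (F 2 - l * F 1) := by
    intro k
    induction k with
    | zero => simp
    | succ k ih =>
      rw [pow_succ', mul_assoc, ← ih, hFrec (k + 1) (by omega)]
      linear_combination F (k + 1) * hchar
  have hdvdF : ∀ t, X ^ t ∣ F t := by
    intro t
    rw [hF, mul_pow]
    exact dvd_sub (Dvd.dvd.mul_left (X_pow_dvd_layeredTailSeries t) _)
      (Dvd.dvd.mul_left (Dvd.intro_left _ rfl) _)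
  have hunit : IsUnit (1 + X ^ 2 - l) := by
    rw [isUnit_iff_constantCoeff]
    simp [hl0]
  have hzero : F 2 - l * F 1 = 0 := by
    ext m
    -- Cancelling the power of the unit, `X ^ (m + 1)` divides `F 2 - l * F 1` for every `m`.
    have hdvd : X ^ (m + 1) ∣ F (m + 2) - l * F (m + 1) :=
      dvd_sub ((pow_dvd_pow X (by omega)).trans (hdvdF _)) (Dvd.dvd.mul_left (hdvdF _) _)
    rw [hH, (hunit.pow m).dvd_mul_left, X_pow_dvd_iff] at hdvd
    rw [hdvd m (Nat.lt_succ_self m), map_zero]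
  rw [hF, hF, layeredTailSeries_two, layeredTailSeries_one] at hzero
  have hne : 1 - l ≠ 0 := fun h => by simpa [hl0] using congrArg constantCoeff h
  apply mul_left_cancel₀ hne
  rw [hRl]
  linear_combination hzero + 2 * X * hchar

theorem lengthGeneratingFunction_eq {R : PowerSeries ℚ} (hR0 : constantCoeff R = 1)
    (hR : R ^ 2 = 1 - 6 * X ^ 2 + X ^ 4) :
    lengthGeneratingFunction (avoidingInvolutions pattern1342) =
      X * (1 - 2 * X + X ^ 2 + R) * (2 * (1 - 3 * X + X ^ 2))⁻¹ := by
  have h : constantCoeff (2 * (1 - 3 * X + X ^ 2) : PowerSeries ℚ) = 2 := by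
    rw [← map_ofNat (C (R := ℚ)) 2, map_mul, constantCoeff_C]
    simp
  rw [PowerSeries.eq_mul_inv_iff_mul_eq (by rw [h]; norm_num)]
  exact two_mul_lengthGeneratingFunction hR0 hR

theorem exists_sqrt_series : ∃ R : PowerSeries ℚ, constantCoeff R = 1 ∧
    R ^ 2 = 1 - 6 * X ^ 2 + X ^ 4 := by
  obtain ⟨T, hT⟩ := exists_schroder_series
  -- The quadratic `X ^ 2 * T ^ 2 - (1 - X ^ 2) * T + 1` has discriminant `1 - 6 * X ^ 2 + X ^ 4`;
  -- this is its square root with constant term 1.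
  refine ⟨1 - X ^ 2 - 2 * X ^ 2 * T, by simp, ?_⟩
  linear_combination (-4 * X ^ 2) * hT

end GeneratingFunction

/-! ### The growth rate -/

-- With `α = 1 + φ`, the array `α ^ m * 2 ^ (n - m)` solves `layeredCount_add_two` up to a multiple
-- of `2 ^ n`, the order of the term at position 0.
open Real in
theorem sum_goldenRatio_pow_mul_two_pow {n m : ℕ} (hm : m ≤ n) :
    ∑ i ∈ Finset.range (m + 1), (1 + goldenRatio) ^ i * 2 ^ (n - i) +
      (1 + goldenRatio) ^ m * 2 ^ (n - m) =
      (1 + goldenRatio) ^ (m + 1) * 2 ^ (n + 1 - m) - 2 * goldenRatio * 2 ^ n := by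
  induction m with
  | zero =>
    simp
    ring
  | succ m ih =>
    have ih := ih (by omega)
    rw [Finset.sum_range_succ]
    obtain ⟨j, rfl⟩ := Nat.exists_eq_add_of_le hm
    rw [show m + 1 + j - m = j + 1 by omega, show m + 1 + j + 1 - m = j + 2 by omega] at ih
    rw [show m + 1 + j - (m + 1) = j by omega, show m + 1 + j + 1 - (m + 1) = j + 1 by omega]
    have h := goldenRatio_sq
    linear_combination ih - (1 + goldenRatio) ^ m * 2 ^ (j + 1) * h

-- A companion solution `α ^ m`, independent of `n`, up to a constant; it serves to adjust the lower
-- bound at the boundary.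
open Real in
theorem sum_goldenRatio_pow (m : ℕ) :
    ∑ i ∈ Finset.range (m + 1), (1 + goldenRatio) ^ i + (1 + goldenRatio) ^ m =
      (1 + goldenRatio) ^ (m + 1) - (goldenRatio - 1) := by
  induction m with
  | zero =>
    simp
    ring
  | succ m ih =>
    rw [Finset.sum_range_succ]
    have h := goldenRatio_sq
    linear_combination ih - (1 + goldenRatio) ^ m * h

-- The defect `2φ * 2 ^ n` exceeds the actual term `2 ^ n`, which gives the upper bound; a quarter
-- of it stays below, as `φ < 2`. The constant `4 - 2φ` makes the lower bounds at `k = n - 1` and `k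
-- = n - 2` equal, as the counts are.
open Real in
theorem layeredCount_bounds (n : ℕ) : ∀ k < n,
    1 / 4 * ((1 + goldenRatio) ^ k * 2 ^ (n - k) - (4 - 2 * goldenRatio) * (1 + goldenRatio) ^ k)
      ≤ layeredCount n k ∧
    (layeredCount n k : ℝ) ≤ (1 + goldenRatio) ^ k * 2 ^ (n - k) := by
  have hφ1 := one_lt_goldenRatio
  have hφ2 := goldenRatio_lt_two
  induction n using Nat.strong_induction_on with
  | _ n ih =>
    have hzero : ∀ n : ℕ, 0 < n → 1 / 4 * ((1 + goldenRatio) ^ 0 * 2 ^ (n - 0) -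
        (4 - 2 * goldenRatio) * (1 + goldenRatio) ^ 0) ≤ layeredCount n 0 ∧
        (layeredCount n 0 : ℝ) ≤ (1 + goldenRatio) ^ 0 * 2 ^ (n - 0) := by
      intro n hn
      obtain ⟨n, rfl⟩ := Nat.exists_eq_succ_of_ne_zero hn.ne'
      have : (0 : ℝ) < 2 ^ n := by positivity
      rw [layeredCount_succ_zero, Nat.sub_zero, pow_succ]
      push_cast
      constructor <;> linarith
    have hrec : ∀ m, m + 2 < n → 1 / 4 * ((1 + goldenRatio) ^ (m + 1) * 2 ^ (n - (m + 1)) -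
        (4 - 2 * goldenRatio) * (1 + goldenRatio) ^ (m + 1)) ≤ layeredCount n (m + 1) ∧
        (layeredCount n (m + 1) : ℝ) ≤ (1 + goldenRatio) ^ (m + 1) * 2 ^ (n - (m + 1)) := by
      intro m hm
      obtain ⟨n, rfl⟩ := Nat.exists_eq_add_of_le' (show 2 ≤ n by omega)
      have hmn : m < n := by omega
      have ih := ih n (by omega)
      rw [layeredCount_add_two hmn, layeredCount_succ_zero,
        show n + 2 - (m + 1) = n + 1 - m by omega]
      push_cast
      have e1 := sum_goldenRatio_pow_mul_two_pow hmn.le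
      have e2 := sum_goldenRatio_pow m
      have hlow := Finset.sum_le_sum fun i (hi : i ∈ Finset.range (m + 1)) =>
        (ih i (by rw [Finset.mem_range] at hi; omega)).1
      have hup := Finset.sum_le_sum fun i (hi : i ∈ Finset.range (m + 1)) =>
        (ih i (by rw [Finset.mem_range] at hi; omega)).2
      rw [← Finset.mul_sum, Finset.sum_sub_distrib, ← Finset.mul_sum] at hlow
      have h2 : (0 : ℝ) < 2 ^ n := by positivity
      have h3 : 0 ≤ (2 - goldenRatio) * 2 ^ n := by nlinarith
      have h4 : 0 ≤ (goldenRatio - 1) * 2 ^ n := by nlinarith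
      have h5 : 0 ≤ (4 - 2 * goldenRatio) * (goldenRatio - 1) :=
        mul_nonneg (by linarith) (by linarith)
      have e3 := congrArg (fun x => (4 - 2 * goldenRatio) * x) e2
      simp only [mul_add, mul_sub (4 - 2 * goldenRatio)] at e3
      have hl := (ih m hmn).1
      have hu := (ih m hmn).2
      constructor <;> linarith
    intro k hk
    match k with
    | 0 => exact hzero n hk
    | m + 1 =>
      rcases Nat.lt_or_ge (m + 2) n with h | h
      · exact hrec m h
      -- The recurrence does not reach `k = n - 1`; there, as at `k = n - 2`, being layered is no
      -- restriction.
      · obtain rfl : n = m + 2 := by omega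
        have heq : layeredCount (m + 2) (m + 1) = layeredCount (m + 2) m := by
          rw [layeredCount_of_le_add_two le_rfl, layeredCount_of_le_add_two (by omega)]
        have hm : 1 / 4 * ((1 + goldenRatio) ^ m * 2 ^ (m + 2 - m) -
            (4 - 2 * goldenRatio) * (1 + goldenRatio) ^ m) ≤ layeredCount (m + 2) m ∧
            (layeredCount (m + 2) m : ℝ) ≤ (1 + goldenRatio) ^ m * 2 ^ (m + 2 - m) := by
          match m with
          | 0 => exact hzero _ (by omega)
          | m + 1 => exact hrec m (by omega)
        rw [Nat.add_sub_cancel_left] at hm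
        rw [heq, show m + 2 - (m + 1) = 1 by omega, pow_succ]
        have h := goldenRatio_sq
        have hpos : 0 < (1 + goldenRatio) ^ m := by positivity
        refine ⟨le_of_eq_of_le ?_ hm.1, hm.2.trans ?_⟩
        · linear_combination (1 / 2 * (1 + goldenRatio) ^ m) * h
        · nlinarith

theorem tendsto_rpow_inv_of_pow_bounds {u : ℕ → ℝ} {a c d : ℝ} (ha : 0 < a) (hc : 0 < c)
    (hd : 0 < d) (hl : ∀ n, 1 ≤ n → c * a ^ n ≤ u n) (hu : ∀ n, 1 ≤ n → u n ≤ d * a ^ n) :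
    Tendsto (fun n : ℕ => u n ^ (1 / (n : ℝ))) atTop (𝓝 a) := by
  have hlim : ∀ b : ℝ, 0 < b →
      Tendsto (fun n : ℕ => b ^ (1 / (n : ℝ)) * a) atTop (𝓝 a) := fun b hb => by
    have : Tendsto (fun n : ℕ => b ^ (1 / (n : ℝ))) atTop (𝓝 (b ^ (0 : ℝ))) :=
      (Real.continuousAt_const_rpow hb.ne').tendsto.comp tendsto_one_div_atTop_nhds_zero_nat
    simpa using this.mul_const a
  have heq : ∀ b : ℝ, 0 < b → ∀ n : ℕ, 1 ≤ n →
      (b * a ^ n) ^ (1 / (n : ℝ)) = b ^ (1 / (n : ℝ)) * a := fun b hb n hn => by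
    rw [Real.mul_rpow hb.le (pow_nonneg ha.le n), one_div,
      Real.pow_rpow_inv_natCast ha.le (by omega)]
  refine tendsto_of_tendsto_of_tendsto_of_le_of_le' (hlim c hc) (hlim d hd) ?_ ?_
  · filter_upwards [eventually_ge_atTop 1] with n hn
    rw [← heq c hc n hn]
    exact Real.rpow_le_rpow (by positivity) (hl n hn) (by positivity)
  · filter_upwards [eventually_ge_atTop 1] with n hn
    rw [← heq d hd n hn]
    exact Real.rpow_le_rpow ((by positivity : 0 ≤ c * a ^ n).trans (hl n hn)) (hu n hn)
      (by positivity)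

open Real in
theorem hasGrowthRate_avoidingInvolutions :
    HasGrowthRate (avoidingInvolutions pattern1342) (1 + goldenRatio) := by
  have hφ := one_lt_goldenRatio
  have hα : 0 < 1 + goldenRatio := by linarith
  have hbounds : ∀ n : ℕ, 1 ≤ n →
      1 / 4 * ((2 * goldenRatio - 2) * (1 + goldenRatio) ^ (n - 1)) ≤
        (avoidingInvolutions pattern1342 n).ncard ∧
      ((avoidingInvolutions pattern1342 n).ncard : ℝ) ≤ 2 * (1 + goldenRatio) ^ (n - 1) := by
    intro n hn
    have h := layeredCount_bounds n (n - 1) (by omega)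
    rw [layeredCount_of_le_add_two (by omega), show n - (n - 1) = 1 by omega] at h
    constructor <;> linarith
  refine tendsto_rpow_inv_of_pow_bounds (c := 1 / 4 * (2 * goldenRatio - 2) / (1 + goldenRatio))
    (d := 2 / (1 + goldenRatio)) hα (div_pos (by linarith) hα) (by positivity) ?_ ?_
  · intro n hn
    refine le_of_eq_of_le ?_ (hbounds n hn).1
    obtain ⟨n, rfl⟩ := Nat.exists_eq_add_of_le' hn
    rw [Nat.add_sub_cancel, pow_succ]
    field_simp
  · intro n hn
    refine (hbounds n hn).2.trans_eq ?_
    obtain ⟨n, rfl⟩ := Nat.exists_eq_add_of_le' hn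
    rw [Nat.add_sub_cancel, pow_succ]
    field_simp

/-- The power series `R` is the formal square root `√(1 - 6x² + x⁴)`, the unique one with constant
term `1`; the inverse is that of a power series with nonzero constant term. -/
theorem mainTheorem1 :
    (∃ R : PowerSeries ℚ,
      PowerSeries.constantCoeff R = 1 ∧
      R ^ 2 = 1 - 6 * PowerSeries.X ^ 2 + PowerSeries.X ^ 4 ∧
      lengthGeneratingFunction (avoidingInvolutions pattern1342) =
        PowerSeries.X * (1 - 2 * PowerSeries.X + PowerSeries.X ^ 2 + R) *
          (2 * (1 - 3 * PowerSeries.X + PowerSeries.X ^ 2))⁻¹) ∧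
    HasGrowthRate (avoidingInvolutions pattern1342) (1 + (1 + Real.sqrt 5) / 2) ∧
    |(1 + (1 + Real.sqrt 5) / 2) - 2.62| < 0.005 := by
  refine ⟨?_, hasGrowthRate_avoidingInvolutions, ?_⟩
  · obtain ⟨R, hR0, hR⟩ := exists_sqrt_series
    exact ⟨R, hR0, hR, lengthGeneratingFunction_eq hR0 hR⟩
  · have h1 : 2.235 < Real.sqrt 5 := Real.lt_sqrt_of_sq_lt (by norm_num)
    have h2 : Real.sqrt 5 < 2.237 := by
      rw [Real.sqrt_lt' (by norm_num)]
      norm_num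
    rw [abs_lt]
    constructor <;> linarith
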